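/- For a bounded potential $V:\mathbb{Z}\to\mathbb{R}$ let $H_V$ be the discrete Schrödinger operator $[H_V\psi](n)=\psi(n+1)+\psi(n-1)+V(n)\psi(n)$ on $\ell^2(\mathbb{Z})$. Write $\sigma(H_V)$ for its spectrum and $\sigma_{\mathrm{ess}}(H_V)$ for its essential spectrum (the spectrum without the isolated eigenvalues of finite multiplicity). Let $\nu_1,\nu_2$ be Borel probability measures on $\mathbb{R}$ whose topological supports are bounded, and let $\nu_i^{\mathbb{Z}}$ be the law of a sequence $\omega=(\omega_n)_{n\in\mathbb{Z}}$ of independent random variables with common distribution $\nu_i$. (1) Let $V_{\mathrm{bg}}:\mathbb{Z}\to\mathbb{R}$ be bounded. For $i=1,2$ there is a unique compact set $\Sigma_i\subset\mathbb{R}$, the almost sure essential spectrum, such that $\sigma_{\mathrm{ess}}(H_{V_{\mathrm{bg}}+\omega})=\Sigma_i$ for $\nu_i^{\mathbb{Z}}$-almost every $\omega$. If $\mathrm{supp}\,\nu_1\subseteq\mathrm{supp}\,\nu_2$, then $\Sigma_1\subseteq\Sigma_2$. (2) Let $T:X\to X$ be a homeomorphism of a non-empty compact metric space $X$ that is minimal,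 that is, $\{T^nx:n\in\mathbb{Z}\}$ is dense in $X$ for every $x\in X$, and let $f:X\to\mathbb{R}$ be continuous. For $i=1,2$ there is a unique compact set $\Sigma_{\nu_i}\subset\mathbb{R}$, the almost sure spectrum, such that for every $x\in X$ and $\nu_i^{\mathbb{Z}}$-almost every $\omega$ we have $\sigma(H_V)=\Sigma_{\nu_i}$ with $V(n)=f(T^nx)+\omega_n$. If $\mathrm{supp}\,\nu_1\subseteq\mathrm{supp}\,\nu_2$, then $\Sigma_{\nu_1}\subseteq\Sigma_{\nu_2}$. -/

import Mathlib

open MeasureTheory Topology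
open scoped ENNReal

namespace RandomSchrodinger

/-- The complex Hilbert space `ℓ²(ℤ)`. -/
abbrev EllTwo : Type := lp (fun _ : ℤ => ℂ) 2

/-- A potential is a real function on `ℤ`; it is bounded if its values are bounded in absolute
value by one constant. -/
def IsBoundedPotential (V : ℤ → ℝ) : Prop :=
  ∃ C : ℝ, ∀ n : ℤ, |V n| ≤ C

theorem memEllTwo_comp (e : ℤ ≃ ℤ) (ψ : EllTwo) :
    Memℓp (fun n : ℤ => (ψ : ℤ → ℂ) (e n)) 2 := by
  have h := lp.memℓp ψ
  rw [memℓp_gen_iff (by norm_num)] at h ⊢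
  exact (e.summable_iff (f := fun n : ℤ => ‖(ψ : ℤ → ℂ) n‖ ^ (2 : ℝ≥0∞).toReal)).2 h

theorem memEllTwo_mul (V : ℤ → ℝ) (hV : IsBoundedPotential V) (ψ : EllTwo) :
    Memℓp (fun n : ℤ => (V n : ℂ) * (ψ : ℤ → ℂ) n) 2 := by
  obtain ⟨C, hC⟩ := hV
  refine ((lp.memℓp ψ).const_smul (C : ℂ)).mono' ?_
  intro n
  simp only [Pi.smul_apply, smul_eq_mul, norm_mul, Complex.norm_real, Real.norm_eq_abs]
  exact mul_le_mul_of_nonneg_right ((hC n).trans (le_abs_self C)) (norm_nonneg _)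

/-- The operator `(R_e ψ)(n) = ψ(e n)` on `ℓ²(ℤ)`, for a permutation `e` of `ℤ`. -/
noncomputable def reindex (e : ℤ ≃ ℤ) : EllTwo →L[ℂ] EllTwo :=
  LinearMap.mkContinuous
    { toFun := fun ψ => ⟨fun n => (ψ : ℤ → ℂ) (e n), memEllTwo_comp e ψ⟩
      map_add' := fun _ _ => rfl
      map_smul' := fun _ _ => rfl } 1 (by
    intro ψ
    rw [one_mul]
    refine lp.norm_le_of_forall_sum_le (by norm_num) (norm_nonneg _) fun s => ?_
    have h := lp.sum_rpow_le_norm_rpow (p := 2) (by norm_num) ψ (s.map e.toEmbedding)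
    rw [Finset.sum_map] at h
    exact h)

/-- The multiplication operator `(M_V ψ)(n) = V(n) ψ(n)` on `ℓ²(ℤ)`, for a bounded potential. -/
noncomputable def mulPotential (V : ℤ → ℝ) (hV : IsBoundedPotential V) : EllTwo →L[ℂ] EllTwo :=
  LinearMap.mkContinuousOfExistsBound
    { toFun := fun ψ => ⟨fun n => (V n : ℂ) * (ψ : ℤ → ℂ) n, memEllTwo_mul V hV ψ⟩
      map_add' := fun ψ φ => by
        ext n
        exact mul_add _ _ _
      map_smul' := fun c ψ => by
        ext n
        exact mul_left_comm _ _ _ } (by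
    obtain ⟨C, hC⟩ := hV
    refine ⟨|C|, fun ψ => ?_⟩
    refine le_trans (lp.norm_mono (p := 2) (by norm_num) (y := (C : ℂ) • ψ) fun n => ?_) ?_
    · simp only [LinearMap.coe_mk, AddHom.coe_mk, lp.coeFn_smul, Pi.smul_apply, smul_eq_mul,
        norm_mul, Complex.norm_real, Real.norm_eq_abs]
      exact mul_le_mul_of_nonneg_right ((hC n).trans (le_abs_self C)) (norm_nonneg _)
    · rw [norm_smul, Complex.norm_real, Real.norm_eq_abs])

/-- The discrete Schrödinger operator `[H ψ](n) = ψ(n+1) + ψ(n-1) + V(n) ψ(n)` on `ℓ²(ℤ)` with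
bounded potential `V`. -/
noncomputable def schrodinger (V : ℤ → ℝ) (hV : IsBoundedPotential V) : EllTwo →L[ℂ] EllTwo :=
  reindex (Equiv.addRight 1) + reindex (Equiv.subRight 1) + mulPotential V hV

theorem schrodinger_apply (V : ℤ → ℝ) (hV : IsBoundedPotential V) (ψ : EllTwo) (n : ℤ) :
    (schrodinger V hV ψ : ℤ → ℂ) n =
      (ψ : ℤ → ℂ) (n + 1) + (ψ : ℤ → ℂ) (n - 1) + (V n : ℂ) * (ψ : ℤ → ℂ) n :=
  rfl

/-- The discrete spectrum of a bounded operator: the isolated points of its spectrum that are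
eigenvalues with a finite-dimensional eigenspace. -/
def discreteSpectrum (A : EllTwo →L[ℂ] EllTwo) : Set ℂ :=
  {z | z ∈ spectrum ℂ A ∧ (∃ ε > 0, ∀ w ∈ spectrum ℂ A, dist w z < ε → w = z) ∧
    Module.End.HasEigenvalue (A : EllTwo →ₗ[ℂ] EllTwo) z ∧
    FiniteDimensional ℂ (Module.End.eigenspace (A : EllTwo →ₗ[ℂ] EllTwo) z)}

/-- The essential spectrum of a (self-adjoint) bounded operator: the complement of the discrete
spectrum in the spectrum. -/
def essentialSpectrum (A : EllTwo →L[ℂ] EllTwo) : Set ℂ :=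
  spectrum ℂ A \ discreteSpectrum A

/-- The law `ν^ℤ`, on real sequences indexed by `ℤ`, of independent random variables with common
distribution `ν`. -/
noncomputable def iidLaw (ν : Measure ℝ) [IsProbabilityMeasure ν] : Measure (ℤ → ℝ) :=
  Measure.infinitePi fun _ : ℤ => ν

/-- `S` is the almost sure essential spectrum of the Schrödinger operator with random potential
`Vbg + ω`, where the `ω n` are independent with distribution `ν`: the set `S ⊆ ℝ` is compact and,
for almost every `ω`, the potential is bounded and the essential spectrum of the operator is `S`
(as a subset of `ℂ`). -/
def IsAlmostSureEssentialSpectrum (Vbg : ℤ → ℝ) (ν : Measure ℝ) [IsProbabilityMeasure ν]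
    (S : Set ℝ) : Prop :=
  IsCompact S ∧ ∀ᵐ ω ∂(iidLaw ν), ∃ hV : IsBoundedPotential (fun n => Vbg n + ω n),
    essentialSpectrum (schrodinger (fun n => Vbg n + ω n) hV) = Complex.ofReal '' S

/-- A homeomorphism is minimal if all of its two-sided orbits are dense. -/
def IsMinimalHomeo {X : Type*} [TopologicalSpace X] (T : X ≃ₜ X) : Prop :=
  ∀ x : X, Dense (Set.range fun n : ℤ => (T ^ n) x)

/-- `S` is the almost sure spectrum of the operators with background potentials `n ↦ f (T^n x)`,
`x ∈ X`, and independent perturbations with distribution `ν`: the set `S ⊆ ℝ` is compact and, for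
every `x` and almost every `ω`, the potential is bounded and the spectrum of the operator is `S`
(as a subset of `ℂ`). -/
def IsAlmostSureSpectrum {X : Type*} [TopologicalSpace X] (T : X ≃ₜ X) (f : C(X, ℝ))
    (ν : Measure ℝ) [IsProbabilityMeasure ν] (S : Set ℝ) : Prop :=
  IsCompact S ∧ ∀ x : X, ∀ᵐ ω ∂(iidLaw ν),
    ∃ hV : IsBoundedPotential (fun n => f ((T ^ n) x) + ω n),
      spectrum ℂ (schrodinger (fun n => f ((T ^ n) x) + ω n) hV) = Complex.ofReal '' S

end RandomSchrodinger

/-! ### Approximate eigenvalues and isolated points of the spectrum of a self-adjoint operator -/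

section SelfAdjoint

open Filter

/-! Both almost sure spectra depend on `ν` only through its support: they equal `windowSpectrum` and
`orbitSpectrum`, in which configurations `q` with values in the support are chosen freely. A larger
support allows more choices of `q`, so both sets are monotone.

The upper bound is deterministic. Almost surely all `ω n` lie in the support, and by
`exists_localized_approx` an approximate eigenvector can be cut down to a window whose length
depends only on the error; `ω` itself then serves as `q`. The lower bound is probabilistic. On a
window of at most `m` sites, `ω` is close to a prescribed `q` with probability at least `p ^ m`,
where `p > 0` is uniform, and disjoint windows are independent. The second Borel–Cantelli lemma
therefore produces such windows away from every finite set (`ae_exists_close`), and Weyl's criterion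
`mem_essentialSpectrum_iff` turns them into essential spectrum.

Over a minimal homeomorphism, every orbit returns infinitely often to every nonempty open set. A
test vector of finite support found over one orbit thus reappears arbitrarily far along every other,
so `orbitSpectrum` equals each `windowSpectrum`, and almost surely the whole spectrum is essential.
-/

theorem algebraMap_sub_apply_norm {H : Type*} [NormedAddCommGroup H] [InnerProductSpace ℂ H]
    (A : H →L[ℂ] H) (z : ℂ) (x : H) :
    ‖(algebraMap ℂ (H →L[ℂ] H) z - A) x‖ = ‖A x - z • x‖ := by
  rw [norm_sub_rev]
  rfl

theorem exists_unit_approx {H : Type*} [NormedAddCommGroup H] [InnerProductSpace ℂ H]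
    {A : H →L[ℂ] H} {z : ℂ} {δ : ℝ}
    (h : ∃ x, x ≠ 0 ∧ ‖A x - z • x‖ < δ * ‖x‖) : ∃ x, ‖x‖ = 1 ∧ ‖A x - z • x‖ < δ := by
  obtain ⟨x, hx, hlt⟩ := h
  have hx' : ‖x‖ ≠ 0 := norm_ne_zero_iff.2 hx
  refine ⟨((‖x‖⁻¹ : ℝ) : ℂ) • x, ?_, ?_⟩
  · rw [norm_smul, Complex.norm_real, norm_inv, norm_norm, inv_mul_cancel₀ hx']
  · rw [map_smul, smul_comm, ← smul_sub, norm_smul, Complex.norm_real, norm_inv, norm_norm,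
      inv_mul_eq_div, div_lt_iff₀ (by positivity)]
    exact hlt

variable {H : Type*} [NormedAddCommGroup H] [InnerProductSpace ℂ H] [CompleteSpace H]

/-- A lower bound gives injectivity and closed range; the range is dense because its orthogonal
complement is the kernel of `B`, which is zero. -/
theorem IsSelfAdjoint.isUnit_of_bounded_below {B : H →L[ℂ] H} (hB : IsSelfAdjoint B) {c : ℝ}
    (hc : 0 < c) (h : ∀ x, c * ‖x‖ ≤ ‖B x‖) : IsUnit B := by
  have hanti : AntilipschitzWith (⟨c, hc.le⟩ : NNReal)⁻¹ B := by
    refine B.antilipschitz_of_bound fun x => ?_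
    have : ((⟨c, hc.le⟩ : NNReal)⁻¹ : NNReal) = (c⁻¹ : ℝ) := rfl
    rw [this, inv_mul_eq_div, le_div_iff₀ hc, mul_comm]
    exact h x
  rw [ContinuousLinearMap.isUnit_iff_bijective,
    ContinuousLinearMap.bijective_iff_dense_range_and_antilipschitz]
  refine ⟨?_, _, hanti⟩
  rw [Submodule.topologicalClosure_eq_top_iff, ContinuousLinearMap.orthogonal_range,
    ContinuousLinearMap.isSelfAdjoint_iff'.1 hB]
  exact LinearMap.ker_eq_bot.2 hanti.injective

theorem IsSelfAdjoint.sub_real_smul {A : H →L[ℂ] H} (hA : IsSelfAdjoint A) (t : ℝ) :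
    IsSelfAdjoint (algebraMap ℂ (H →L[ℂ] H) t - A) := by
  refine IsSelfAdjoint.sub ?_ hA
  rw [IsSelfAdjoint, ← algebraMap_star_comm]
  simp

/-- A real number is in the spectrum of a bounded self-adjoint operator if and only if it is an
approximate eigenvalue. -/
theorem IsSelfAdjoint.mem_spectrum_iff_approx {A : H →L[ℂ] H} (hA : IsSelfAdjoint A) (t : ℝ) :
    (t : ℂ) ∈ spectrum ℂ A ↔ ∀ ε : ℝ, 0 < ε → ∃ x, x ≠ 0 ∧ ‖A x - (t : ℂ) • x‖ < ε * ‖x‖ := by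
  constructor
  · intro h ε hε
    by_contra! hcon
    refine h ((hA.sub_real_smul t).isUnit_of_bounded_below hε fun x => ?_)
    rw [algebraMap_sub_apply_norm]
    rcases eq_or_ne x 0 with rfl | hx
    · simp
    · exact hcon x hx
  · rintro h ⟨u, hu⟩
    obtain ⟨x, hx, hlt⟩ := h (‖(↑u⁻¹ : H →L[ℂ] H)‖ + 1)⁻¹ (by positivity)
    have h1 : (↑u⁻¹ : H →L[ℂ] H) ((algebraMap ℂ (H →L[ℂ] H) t - A) x) = x := by
      rw [← hu, ← mul_apply_eq_comp, Units.inv_mul]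
      rfl
    have h2 := (↑u⁻¹ : H →L[ℂ] H).le_opNorm ((algebraMap ℂ (H →L[ℂ] H) t - A) x)
    rw [h1, algebraMap_sub_apply_norm] at h2
    rw [inv_mul_eq_div, lt_div_iff₀ (by positivity)] at hlt
    nlinarith [norm_nonneg (A x - (t : ℂ) • x)]

/-- At an isolated point `t` of the spectrum of a self-adjoint operator `A`, the operator `A - t`
is bounded below on the orthogonal complement of the eigenspace. -/
theorem IsSelfAdjoint.bounded_below_of_isolated {A : H →L[ℂ] H} (hA : IsSelfAdjoint A) {t : ℝ}
    (hiso : ∃ ε > 0, ∀ w ∈ spectrum ℂ A, dist w t < ε → w = t) :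
    ∃ c : ℝ, 0 < c ∧ ∀ x ∈ (Module.End.eigenspace (A : H →ₗ[ℂ] H) (t : ℂ))ᗮ,
      c * ‖x‖ ≤ ‖A x - (t : ℂ) • x‖ := by
  classical
  obtain ⟨ε, hε, hiso⟩ := hiso
  have hreal : ∀ s ∈ spectrum ℝ A, s ≠ t → ε ≤ |s - t| := by
    intro s hs hst
    by_contra! hlt
    have := hiso s ((spectrum.algebraMap_mem_iff ℂ).2 hs) (by
      rwa [Complex.dist_eq, ← Complex.ofReal_sub, Complex.norm_real, Real.norm_eq_abs])
    exact hst (by exact_mod_cast this)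
  -- Since `t` is isolated, a function may jump or blow up there and still be continuous on the
  -- spectrum.
  have hcont : ∀ f : ℝ → ℝ, ContinuousOn f {t}ᶜ → ContinuousOn f (spectrum ℝ A) := by
    intro f hf s hs
    rcases eq_or_ne s t with rfl | hst
    · have : 𝓝[spectrum ℝ A] s ≤ pure s := by
        rw [nhdsWithin, Filter.le_pure_iff, Filter.mem_inf_principal]
        filter_upwards [Metric.ball_mem_nhds s hε] with r hr hrs
        by_contra hne
        exact absurd (hreal r hrs hne) (by simpa [Real.dist_eq] using hr)
      exact (tendsto_pure_nhds f s).mono_left this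
    · exact (hf.continuousAt (isOpen_compl_singleton.mem_nhds hst)).continuousWithinAt
  -- `g` yields the reduced resolvent and `p` the spectral projection at `t`. The identity `g s * (s
  -- - t) + p s = 1` holds at `s = t` too, where `0⁻¹ = 0`.
  set g : ℝ → ℝ := fun s => (s - t)⁻¹ with hg
  have hgc : ContinuousOn g (spectrum ℝ A) := hcont g fun s hs =>
    ((continuousAt_id.sub continuousAt_const).inv₀ (sub_ne_zero.2 hs)).continuousWithinAt
  set p : ℝ → ℝ := fun s => if s = t then 1 else 0 with hp
  have hpc : ContinuousOn p (spectrum ℝ A) := hcont p <| by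
    refine (continuousOn_const (c := (0 : ℝ))).congr fun s hs => ?_
    rw [hp]
    exact if_neg hs
  have hsub : cfc (fun s : ℝ => s - t) A = A - algebraMap ℂ (H →L[ℂ] H) t := by
    rw [cfc_sub (fun s : ℝ => s) (fun _ => t) A, cfc_id' ℝ A, cfc_const t A]
    congr 1
  have hP : IsSelfAdjoint (cfc p A) := cfc_predicate p A
  have h1 : (A - algebraMap ℂ (H →L[ℂ] H) t) * cfc p A = 0 := by
    rw [← hsub, ← cfc_mul _ _ A (by fun_prop) hpc]
    rw [show (fun s => (s - t) * p s) = fun _ => (0 : ℝ) by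
      ext s; by_cases h : s = t <;> simp [hp, h]]
    simp
  have h2 : cfc g A * (A - algebraMap ℂ (H →L[ℂ] H) t) + cfc p A = 1 := by
    rw [← hsub, ← cfc_mul _ _ A hgc (by fun_prop), ← cfc_add A _ _ (by fun_prop) hpc]
    rw [show (fun s => g s * (s - t) + p s) = fun _ => (1 : ℝ) by
      ext s
      by_cases h : s = t
      · simp [hp, h]
      · simp [hp, hg, h, sub_ne_zero.2 h]]
    exact cfc_const_one ℝ A
  have hmem : ∀ x, cfc p A x ∈ Module.End.eigenspace (A : H →ₗ[ℂ] H) (t : ℂ) := by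
    intro x
    rw [Module.End.mem_eigenspace_iff]
    exact sub_eq_zero.1 (DFunLike.congr_fun h1 x)
  refine ⟨(‖cfc g A‖ + 1)⁻¹, by positivity, fun x hx => ?_⟩
  have h3 : cfc p A x = 0 := by
    rw [← inner_self_eq_zero (𝕜 := ℂ)]
    have := ContinuousLinearMap.isSelfAdjoint_iff_isSymmetric.1 hP (cfc p A x) x
    exact this.symm.trans ((Submodule.mem_orthogonal _ _).1 hx _ (hmem _))
  have h4 : cfc g A (A x - (t : ℂ) • x) = x := by
    have := DFunLike.congr_fun h2 x
    change cfc g A (A x - (t : ℂ) • x) + cfc p A x = x at this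
    rwa [h3, add_zero] at this
  have h5 := (cfc g A).le_opNorm (A x - (t : ℂ) • x)
  rw [h4] at h5
  rw [inv_mul_eq_div, div_le_iff₀ (by positivity)]
  nlinarith [norm_nonneg (A x - (t : ℂ) • x)]

/-! ### Lower bounds up to a finite rank error -/

section Compactness

variable {F : Type*} [NormedAddCommGroup F] [NormedSpace ℂ F] [FiniteDimensional ℂ F]

/-- The bounded sequence `P (u n)` has a convergent subsequence in finite dimension; `hbound`
applied to differences makes the same subsequence of `u` Cauchy. -/
theorem exists_subseq_tendsto_of_approx {B : H →L[ℂ] H} {P : H →L[ℂ] F} {c C : ℝ} (hc : 0 < c)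
    (hC : 0 ≤ C) (hbound : ∀ x, c * ‖x‖ ≤ ‖B x‖ + C * ‖P x‖) {u : ℕ → H} (hu : ∀ n, ‖u n‖ = 1)
    (hBu : Tendsto (fun n => B (u n)) atTop (𝓝 0)) :
    ∃ x, ‖x‖ = 1 ∧ B x = 0 ∧ ∃ φ : ℕ → ℕ, StrictMono φ ∧ Tendsto (u ∘ φ) atTop (𝓝 x) := by
  have : ProperSpace F := FiniteDimensional.proper ℂ F
  obtain ⟨y, -, φ, hφ, hy⟩ := (isCompact_closedBall (0 : F) ‖P‖).tendsto_subseq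
    (x := fun n => P (u n)) fun n => by
      simpa [hu n] using P.le_opNorm (u n)
  have hBφ : Tendsto (fun n => B (u (φ n))) atTop (𝓝 0) := hBu.comp hφ.tendsto_atTop
  have hcauchy : CauchySeq (u ∘ φ) := by
    rw [Metric.cauchySeq_iff]
    intro ε hε
    obtain ⟨N₁, hN₁⟩ := Metric.cauchySeq_iff.1 hBφ.cauchySeq (c * ε / 2) (by positivity)
    obtain ⟨N₂, hN₂⟩ := Metric.cauchySeq_iff.1 hy.cauchySeq (c * ε / (2 * (C + 1)))
      (by positivity)
    refine ⟨max N₁ N₂, fun m hm n hn => ?_⟩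
    have e1 := hN₁ m (le_of_max_le_left hm) n (le_of_max_le_left hn)
    have e2 := hN₂ m (le_of_max_le_right hm) n (le_of_max_le_right hn)
    simp only [Function.comp_apply, dist_eq_norm, ← map_sub] at e1 e2 ⊢
    have e3 := hbound (u (φ m) - u (φ n))
    rw [lt_div_iff₀ (by positivity)] at e2
    have e4 := norm_nonneg (P (u (φ m) - u (φ n)))
    refine lt_of_mul_lt_mul_left (a := c) ?_ hc.le
    nlinarith
  obtain ⟨x, hx⟩ := cauchySeq_tendsto_of_complete hcauchy
  refine ⟨x, ?_, ?_, φ, hφ, hx⟩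
  · exact tendsto_nhds_unique hx.norm (by simp [hu])
  · exact tendsto_nhds_unique ((B.continuous.tendsto x).comp hx) hBφ

/-- If `A - t` is bounded below up to a finite rank error, then a spectral value `t` of the
self-adjoint operator `A` is an isolated eigenvalue of finite multiplicity. -/
theorem IsSelfAdjoint.isolated_eigenvalue_of_bound {A : H →L[ℂ] H} (hA : IsSelfAdjoint A) {t : ℝ}
    {P : H →L[ℂ] F} {c C : ℝ} (hc : 0 < c) (hC : 0 ≤ C)
    (hbound : ∀ x, c * ‖x‖ ≤ ‖A x - (t : ℂ) • x‖ + C * ‖P x‖) (ht : (t : ℂ) ∈ spectrum ℂ A) :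
    (∃ ε > 0, ∀ w ∈ spectrum ℂ A, dist w (t : ℂ) < ε → w = t) ∧
    Module.End.HasEigenvalue (A : H →ₗ[ℂ] H) (t : ℂ) ∧
    FiniteDimensional ℂ (Module.End.eigenspace (A : H →ₗ[ℂ] H) (t : ℂ)) := by
  set B : H →L[ℂ] H := A - algebraMap ℂ (H →L[ℂ] H) t with hBdef
  have hB : ∀ x, B x = A x - (t : ℂ) • x := fun x => rfl
  have hbound' : ∀ x, c * ‖x‖ ≤ ‖B x‖ + C * ‖P x‖ := hbound
  have hmem : ∀ x, B x = 0 → A x = (t : ℂ) • x := fun x hx => sub_eq_zero.1 ((hB x).symm.trans hx)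
  refine ⟨?_, ?_, ?_⟩
  · by_contra! hcon
    choose! w hw hwt hne using fun n : ℕ => hcon (1 / ((n : ℝ) + 1)) (by positivity)
    have hwre : ∀ n, w n = ((w n).re : ℂ) := fun n => hA.mem_spectrum_eq_re (hw n)
    -- The factor `‖w n - t‖` in the error cancels in `(t - w n) * ⟪x, u n⟫ = ⟪x, (A - w n) (u n)⟫`.
    -- So `u n` becomes orthogonal to the unit eigenvector `x`, although a subsequence converges to
    -- `x`.
    have happ : ∀ n, ∃ x, ‖x‖ = 1 ∧ ‖A x - w n • x‖ < ‖w n - t‖ * (1 / ((n : ℝ) + 1)) := by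
      intro n
      refine exists_unit_approx ?_
      have h1 := hw n
      rw [hwre n] at h1
      have h2 := (hA.mem_spectrum_iff_approx _).1 h1 (‖w n - t‖ * (1 / ((n : ℝ) + 1)))
        (mul_pos (norm_pos_iff.2 (sub_ne_zero.2 (hne n))) (by positivity))
      rwa [← hwre n] at h2
    choose u hu hAu using happ
    have hwn : ∀ n, ‖w n - t‖ < 1 / ((n : ℝ) + 1) := fun n => by
      simpa [dist_eq_norm] using hwt n
    have hone : ∀ n : ℕ, 1 / ((n : ℝ) + 1) ≤ 1 := fun n => by
      rw [div_le_one (by positivity)]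
      linarith [Nat.cast_nonneg (α := ℝ) n]
    have hBu : Tendsto (fun n => B (u n)) atTop (𝓝 0) := by
      refine squeeze_zero_norm (a := fun n : ℕ => 2 * (1 / ((n : ℝ) + 1))) (fun n => ?_) ?_
      · have e : B (u n) = (A (u n) - w n • u n) + (w n - t) • u n := by
          rw [hB, sub_smul]
          abel
        rw [e]
        refine (norm_add_le _ _).trans ?_
        rw [norm_smul, hu n, mul_one]
        have e1 := hAu n
        have e2 := hwn n
        have e3 := hone n
        nlinarith [norm_nonneg (w n - t)]
      · simpa using tendsto_one_div_add_atTop_nhds_zero_nat.const_mul (2 : ℝ)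
    obtain ⟨x, hx1, hx0, φ, hφ, hx⟩ := exists_subseq_tendsto_of_approx hc hC hbound' hu hBu
    have hin : ∀ n, ‖inner ℂ x (u n)‖ ≤ 1 / ((n : ℝ) + 1) := by
      intro n
      have e1 : inner ℂ x (A (u n) - w n • u n) = (t - w n) * inner ℂ x (u n) := by
        have := ContinuousLinearMap.isSelfAdjoint_iff_isSymmetric.1 hA x (u n)
        change inner ℂ (A x) (u n) = inner ℂ x (A (u n)) at this
        rw [inner_sub_right, ← this, hmem x hx0, inner_smul_left, inner_smul_right,
          Complex.conj_ofReal]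
        ring
      have e2 := norm_inner_le_norm (𝕜 := ℂ) x (A (u n) - w n • u n)
      rw [e1, norm_mul, hx1, one_mul, norm_sub_rev] at e2
      exact le_of_mul_le_mul_left (e2.trans (hAu n).le)
        (norm_pos_iff.2 (sub_ne_zero.2 (hne n)))
    have h0 : Tendsto (fun n => inner ℂ x (u n)) atTop (𝓝 0) :=
      squeeze_zero_norm hin tendsto_one_div_add_atTop_nhds_zero_nat
    have h1 : Tendsto (fun n => inner ℂ x ((u ∘ φ) n)) atTop (𝓝 (inner ℂ x x)) :=
      tendsto_const_nhds.inner hx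
    have h2 : inner ℂ x x = 0 := tendsto_nhds_unique h1 (h0.comp hφ.tendsto_atTop)
    rw [inner_self_eq_zero] at h2
    simp [h2] at hx1
  · have happ : ∀ n : ℕ, ∃ x, ‖x‖ = 1 ∧ ‖A x - (t : ℂ) • x‖ < 1 / ((n : ℝ) + 1) := fun n =>
      exists_unit_approx ((hA.mem_spectrum_iff_approx t).1 ht _ (by positivity))
    choose u hu hAu using happ
    obtain ⟨x, hx1, hx0, -⟩ := exists_subseq_tendsto_of_approx hc hC hbound' hu
      (squeeze_zero_norm (fun n => (hAu n).le) tendsto_one_div_add_atTop_nhds_zero_nat)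
    refine Module.End.hasEigenvalue_of_hasEigenvector (x := x) ⟨?_, ?_⟩
    · exact Module.End.mem_eigenspace_iff.2 (hmem x hx0)
    · rintro rfl
      simp at hx1
  -- On the eigenspace the bound reads `c * ‖x‖ ≤ C * ‖P x‖`, so `P` is injective there.
  · refine FiniteDimensional.of_injective
      ((P : H →ₗ[ℂ] F).comp (Module.End.eigenspace (A : H →ₗ[ℂ] H) (t : ℂ)).subtype) ?_
    rw [← LinearMap.ker_eq_bot, LinearMap.ker_eq_bot']
    rintro ⟨x, hx⟩ h0
    have h1 : A x = (t : ℂ) • x := Module.End.mem_eigenspace_iff.1 hx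
    have h2 : P x = 0 := h0
    have h3 := hbound x
    rw [h1, h2, sub_self, norm_zero, norm_zero, mul_zero, add_zero] at h3
    have h4 : ‖x‖ ≤ 0 := by
      by_contra! h
      nlinarith
    exact Subtype.ext (norm_le_zero_iff.1 h4)

end Compactness

end SelfAdjoint

namespace RandomSchrodinger

/-! ### Weyl's criterion on `ℓ²(ℤ)` -/

section Weyl

/-- The restriction of a sequence in `ℓ²(ℤ)` to a finite set of sites. -/
noncomputable def siteValues (s : Finset ℤ) : EllTwo →L[ℂ] (s → ℂ) :=
  ContinuousLinearMap.pi fun i => innerSL ℂ (lp.single 2 (i : ℤ) (1 : ℂ) : EllTwo)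

theorem siteValues_apply (s : Finset ℤ) (ψ : EllTwo) (i : s) : siteValues s ψ i = ψ (i : ℤ) := by
  change inner ℂ (lp.single 2 (i : ℤ) (1 : ℂ) : EllTwo) ψ = _
  rw [lp.inner_single_left]
  simp

/-- The truncation of a sequence in `ℓ²(ℤ)` to a finite set of sites. -/
noncomputable def truncate (s : Finset ℤ) (ψ : EllTwo) : EllTwo :=
  ∑ i ∈ s, lp.single 2 i (ψ i)

theorem truncate_apply_of_mem {s : Finset ℤ} (ψ : EllTwo) {n : ℤ} (hn : n ∈ s) :
    (truncate s ψ : ℤ → ℂ) n = ψ n := by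
  rw [truncate, lp.coeFn_sum, Finset.sum_apply]
  simp only [lp.coeFn_single]
  rw [Finset.sum_eq_single_of_mem n hn fun m _ hm => Pi.single_eq_of_ne hm.symm _]
  simp

theorem norm_truncate_le (s : Finset ℤ) (ψ : EllTwo) :
    ‖truncate s ψ‖ ≤ s.card * ‖siteValues s ψ‖ := by
  refine (norm_sum_le _ _).trans ?_
  rw [← nsmul_eq_mul]
  refine Finset.sum_le_card_nsmul _ _ _ fun i hi => ?_
  rw [lp.norm_single (by norm_num), ← siteValues_apply s ψ ⟨i, hi⟩]
  exact norm_le_pi_norm (siteValues s ψ) ⟨i, hi⟩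

/-- A vector vanishing on a large finite set meets only the tail of `φ`, which has small norm. -/
theorem exists_inner_le_of_vanishing (φ : EllTwo) {δ : ℝ} (hδ : 0 < δ) :
    ∃ s : Finset ℤ, ∀ t, s ⊆ t → ∀ ψ : EllTwo, (∀ n ∈ t, ψ n = 0) →
      ‖inner ℂ φ ψ‖ ≤ δ * ‖ψ‖ := by
  have h := lp.hasSum_single (by norm_num : (2 : ℝ≥0∞) ≠ ∞) φ
  obtain ⟨s, hs⟩ := (Metric.tendsto_atTop.1 h) δ hδ
  refine ⟨s, fun t hst ψ hψ => ?_⟩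
  have h0 : inner ℂ (truncate t φ) ψ = 0 := by
    rw [truncate, sum_inner]
    refine Finset.sum_eq_zero fun i hi => ?_
    rw [lp.inner_single_left, hψ i hi, inner_zero_right]
  have h1 : inner ℂ φ ψ = inner ℂ (φ - truncate t φ) ψ := by
    rw [inner_sub_left, h0, sub_zero]
  rw [h1]
  refine (norm_inner_le_norm _ _).trans (mul_le_mul_of_nonneg_right ?_ (norm_nonneg _))
  have := (hs t hst).le
  rwa [dist_comm, dist_eq_norm] at this

theorem exists_projection_le_of_vanishing (E : Submodule ℂ EllTwo) [FiniteDimensional ℂ E]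
    {δ : ℝ} (hδ : 0 < δ) :
    ∃ s : Finset ℤ, ∀ ψ : EllTwo, (∀ n ∈ s, ψ n = 0) → ‖E.starProjection ψ‖ ≤ δ * ‖ψ‖ := by
  set b := stdOrthonormalBasis ℂ E
  set d : ℝ := (Module.finrank ℂ E : ℝ)
  have hd : 0 ≤ d := Nat.cast_nonneg _
  choose s hs using fun i => exists_inner_le_of_vanishing (b i : EllTwo)
    (δ := δ / (d + 1)) (by positivity)
  refine ⟨Finset.univ.biUnion s, fun ψ hψ => ?_⟩
  have hterm : ∀ i ∈ (Finset.univ : Finset (Fin (Module.finrank ℂ E))),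
      ‖InnerProductSpace.rankOne ℂ (b i : EllTwo) (b i : EllTwo) ψ‖ ≤ δ / (d + 1) * ‖ψ‖ := by
    intro i _
    rw [InnerProductSpace.rankOne_apply, norm_smul,
      show ‖(b i : EllTwo)‖ = 1 from b.norm_eq_one i, mul_one]
    exact hs i _ (Finset.subset_biUnion_of_mem s (Finset.mem_univ i)) ψ hψ
  rw [b.starProjection_eq_sum_rankOne, sum_apply]
  refine (norm_sum_le _ _).trans ((Finset.sum_le_card_nsmul _ _ _ hterm).trans ?_)
  rw [nsmul_eq_mul, Finset.card_univ, Fintype.card_fin, ← mul_assoc]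
  refine mul_le_mul_of_nonneg_right ?_ (norm_nonneg _)
  change d * (δ / (d + 1)) ≤ δ
  rw [mul_div_assoc', div_le_iff₀ (by positivity)]
  nlinarith

/-- Weyl's criterion: the essential spectrum of a self-adjoint operator on `ℓ²(ℤ)` consists of the
numbers that have approximate eigenvectors vanishing on any prescribed finite set. -/
theorem mem_essentialSpectrum_iff {A : EllTwo →L[ℂ] EllTwo} (hA : IsSelfAdjoint A) (t : ℝ) :
    (t : ℂ) ∈ essentialSpectrum A ↔ ∀ ε : ℝ, 0 < ε → ∀ s : Finset ℤ,
      ∃ ψ : EllTwo, ψ ≠ 0 ∧ (∀ n ∈ s, ψ n = 0) ∧ ‖A ψ - (t : ℂ) • ψ‖ < ε * ‖ψ‖ := by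
  constructor
  · rintro ⟨hspec, hdisc⟩ ε hε s
    by_contra! hcon
    -- Passing from `ψ` to `ψ - truncate s ψ` changes `(A - t) ψ` by at most `‖A - t‖ * ‖truncate s
    -- ψ‖` and `ε * ‖ψ‖` by at most `ε * ‖truncate s ψ‖`.
    set M : ℝ := ‖A - algebraMap ℂ (EllTwo →L[ℂ] EllTwo) t‖ + ε
    have hM : 0 ≤ M := by positivity
    refine hdisc ⟨hspec, hA.isolated_eigenvalue_of_bound (P := siteValues s) hε
      (C := M * s.card) (by positivity) (fun ψ => ?_) hspec⟩
    have h1 : ε * ‖ψ - truncate s ψ‖ ≤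
        ‖A (ψ - truncate s ψ) - (t : ℂ) • (ψ - truncate s ψ)‖ := by
      rcases eq_or_ne (ψ - truncate s ψ) 0 with h0 | h0
      · simp [h0]
      · refine hcon _ h0 fun n hn => ?_
        rw [lp.coeFn_sub, Pi.sub_apply, truncate_apply_of_mem ψ hn, sub_self]
    have h2 : A (ψ - truncate s ψ) - (t : ℂ) • (ψ - truncate s ψ) =
        (A ψ - (t : ℂ) • ψ) - (A - algebraMap ℂ (EllTwo →L[ℂ] EllTwo) t) (truncate s ψ) := by
      change _ = (A ψ - (t : ℂ) • ψ) - (A (truncate s ψ) - (t : ℂ) • truncate s ψ)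
      rw [map_sub, smul_sub]
      abel
    rw [h2] at h1
    have h3 := norm_sub_le (A ψ - (t : ℂ) • ψ)
      ((A - algebraMap ℂ (EllTwo →L[ℂ] EllTwo) t) (truncate s ψ))
    have h4 := (A - algebraMap ℂ (EllTwo →L[ℂ] EllTwo) t).le_opNorm (truncate s ψ)
    have h5 : ‖ψ‖ ≤ ‖ψ - truncate s ψ‖ + ‖truncate s ψ‖ := by
      simpa using norm_add_le (ψ - truncate s ψ) (truncate s ψ)
    have h6 := mul_le_mul_of_nonneg_left (norm_truncate_le s ψ) hM
    have h7 := mul_le_mul_of_nonneg_left h5 hε.le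
    have h8 : M * ‖truncate s ψ‖ = ‖A - algebraMap ℂ (EllTwo →L[ℂ] EllTwo) t‖ * ‖truncate s ψ‖ +
      ε * ‖truncate s ψ‖ := add_mul _ _ _
    rw [← mul_assoc] at h6
    linarith
  · intro h
    refine ⟨(hA.mem_spectrum_iff_approx t).2 fun ε hε => ?_, ?_⟩
    · obtain ⟨ψ, h0, -, h1⟩ := h ε hε ∅
      exact ⟨ψ, h0, h1⟩
    · rintro ⟨-, hiso, -, hfin⟩
      obtain ⟨c, hc, hbelow⟩ := hA.bounded_below_of_isolated hiso
      set E := Module.End.eigenspace (A : EllTwo →ₗ[ℂ] EllTwo) (t : ℂ)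
      -- Vanishing on `s` leaves at least half of `‖ψ‖` orthogonal to `E`, where `A - t` is bounded
      -- below by `c`; this contradicts an error below `c / 2`.
      obtain ⟨s, hs⟩ := exists_projection_le_of_vanishing E (δ := 1 / 2) (by norm_num)
      obtain ⟨ψ, h0, hψ, h1⟩ := h (c / 2) (by positivity) s
      have h2 := hbelow _ (E.sub_starProjection_mem_orthogonal ψ)
      have h3 : A (E.starProjection ψ) = (t : ℂ) • E.starProjection ψ :=
        Module.End.mem_eigenspace_iff.1 (E.starProjection_apply_mem ψ)
      have h4 : A (ψ - E.starProjection ψ) - (t : ℂ) • (ψ - E.starProjection ψ) =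
          A ψ - (t : ℂ) • ψ := by
        rw [map_sub, h3, smul_sub]
        abel
      rw [h4] at h2
      have h5 := hs ψ hψ
      have h6 : ‖ψ‖ ≤ ‖ψ - E.starProjection ψ‖ + ‖E.starProjection ψ‖ := by
        simpa using norm_add_le (ψ - E.starProjection ψ) (E.starProjection ψ)
      have h7 : c * (1 / 2 * ‖ψ‖) ≤ c * ‖ψ - E.starProjection ψ‖ :=
        mul_le_mul_of_nonneg_left (by linarith) hc.le
      linarith

end Weyl

/-! ### Self-adjointness of Schrödinger operators -/

theorem isSelfAdjoint_mulPotential (V : ℤ → ℝ) (hV : IsBoundedPotential V) :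
    IsSelfAdjoint (mulPotential V hV) := by
  refine ContinuousLinearMap.isSelfAdjoint_iff_isSymmetric.2 fun φ ψ => ?_
  rw [lp.inner_eq_tsum, lp.inner_eq_tsum]
  refine tsum_congr fun n => ?_
  change inner ℂ ((V n : ℂ) * φ n) (ψ n) = inner ℂ (φ n) ((V n : ℂ) * ψ n)
  simp only [RCLike.inner_apply, map_mul, Complex.conj_ofReal]
  ring

theorem inner_reindex (e : ℤ ≃ ℤ) (φ ψ : EllTwo) :
    inner ℂ (reindex e φ) ψ = inner ℂ φ (reindex e.symm ψ) := by
  rw [lp.inner_eq_tsum, lp.inner_eq_tsum,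
    ← e.tsum_eq fun n => inner ℂ (φ n) ((reindex e.symm ψ : ℤ → ℂ) n)]
  refine tsum_congr fun n => ?_
  change inner ℂ (φ (e n)) (ψ n) = inner ℂ (φ (e n)) (ψ (e.symm (e n)))
  rw [e.symm_apply_apply]

theorem isSelfAdjoint_schrodinger (V : ℤ → ℝ) (hV : IsBoundedPotential V) :
    IsSelfAdjoint (schrodinger V hV) := by
  refine IsSelfAdjoint.add ?_ (isSelfAdjoint_mulPotential V hV)
  refine ContinuousLinearMap.isSelfAdjoint_iff_isSymmetric.2 fun φ ψ => ?_
  change inner ℂ (reindex (Equiv.addRight 1) φ + reindex (Equiv.subRight 1) φ) ψ =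
    inner ℂ φ (reindex (Equiv.addRight 1) ψ + reindex (Equiv.subRight 1) ψ)
  have h1 : (Equiv.addRight (1 : ℤ)).symm = Equiv.subRight 1 := by
    ext n
    rfl
  rw [inner_add_left, inner_add_right, inner_reindex, inner_reindex, ← h1, Equiv.symm_symm,
    add_comm]

end RandomSchrodinger

namespace RandomSchrodinger

/-! ### Localization of approximate eigenvectors by averaging over translated tents -/

section Localization

theorem ofReal_norm_sq_eq_tsum (ψ : EllTwo) :
    ENNReal.ofReal (‖ψ‖ ^ 2) = ∑' n, ENNReal.ofReal (‖ψ n‖ ^ 2) := by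
  have h := lp.hasSum_norm (p := 2) (by norm_num) ψ
  simp only [ENNReal.toReal_ofNat, Real.rpow_ofNat] at h
  rw [← ENNReal.ofReal_tsum_of_nonneg (fun n => by positivity) h.summable, h.tsum_eq]

theorem tsum_tsum_translate (g h : ℤ → ℝ≥0∞) :
    ∑' j, ∑' n, g (n - j) * h n = (∑' k, g k) * ∑' n, h n := by
  rw [ENNReal.tsum_comm, ← ENNReal.tsum_mul_left]
  refine tsum_congr fun n => ?_
  rw [ENNReal.tsum_mul_right]
  congr 1
  exact (Equiv.subLeft n).tsum_eq g

theorem norm_sq_add_three_le (a b c : ℂ) :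
    ‖a + b + c‖ ^ 2 ≤ 3 * (‖a‖ ^ 2 + ‖b‖ ^ 2 + ‖c‖ ^ 2) := by
  have h : ‖a + b + c‖ ≤ ‖a‖ + ‖b‖ + ‖c‖ := norm_add₃_le
  have h2 : ‖a + b + c‖ ^ 2 ≤ (‖a‖ + ‖b‖ + ‖c‖) ^ 2 := by gcongr
  nlinarith [sq_nonneg (‖a‖ - ‖b‖), sq_nonneg (‖b‖ - ‖c‖), sq_nonneg (‖a‖ - ‖c‖)]

/-- The tent function of height and radius `L`. -/
noncomputable def tent (L : ℕ) (k : ℤ) : ℝ := max 0 (L - |(k : ℝ)|)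

theorem tent_nonneg (L : ℕ) (k : ℤ) : 0 ≤ tent L k := le_max_left _ _

theorem tent_eq_zero {L : ℕ} {k : ℤ} (hk : k ∉ Finset.Icc (-(L : ℤ)) L) : tent L k = 0 := by
  rw [Finset.mem_Icc, ← abs_le, not_le] at hk
  have : (L : ℝ) < |(k : ℝ)| := by exact_mod_cast hk
  exact max_eq_left (by linarith)

theorem tent_le (L : ℕ) (k : ℤ) : tent L k ≤ L :=
  max_le (Nat.cast_nonneg L) (by linarith [abs_nonneg (k : ℝ)])

theorem isBoundedPotential_tent (L : ℕ) (j : ℤ) : IsBoundedPotential fun n => tent L (n - j) :=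
  ⟨L, fun n => by rw [abs_of_nonneg (tent_nonneg _ _)]; exact tent_le _ _⟩

theorem tent_sub_sq_le (L : ℕ) (k m : ℤ) : (tent L k - tent L m) ^ 2 ≤ ((k : ℝ) - m) ^ 2 := by
  rw [sq_le_sq, tent, tent, max_comm 0, max_comm 0]
  refine (abs_max_sub_max_le_abs _ _ _).trans ?_
  rw [sub_sub_sub_cancel_left, abs_sub_comm (k : ℝ)]
  exact abs_abs_sub_abs_le _ _

theorem tsum_tent_sq_ne_top (L : ℕ) : ∑' k, ENNReal.ofReal (tent L k ^ 2) ≠ ∞ := by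
  rw [tsum_eq_sum (s := Finset.Icc (-(L : ℤ)) L) fun k hk => by rw [tent_eq_zero hk]; simp]
  exact ENNReal.sum_ne_top.2 fun _ _ => ENNReal.ofReal_ne_top

/-- The single term `k = 0` suffices: `L ^ 2` already dominates the linear bound of
`tsum_tent_diff_le`. -/
theorem le_tsum_tent_sq (L : ℕ) :
    ENNReal.ofReal ((L : ℝ) ^ 2) ≤ ∑' k, ENNReal.ofReal (tent L k ^ 2) := by
  refine le_trans (le_of_eq ?_) (ENNReal.le_tsum 0)
  simp [tent]

theorem tsum_tent_diff_le (L : ℕ) {e : ℤ} (he : |e| = 1) :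
    ∑' k, ENNReal.ofReal ((tent L (k + e) - tent L k) ^ 2) ≤ ENNReal.ofReal (2 * L + 3) := by
  rw [tsum_eq_sum (s := Finset.Icc (-(L + 1 : ℤ)) (L + 1)) fun k hk => ?_]
  · refine (Finset.sum_le_card_nsmul _ _ 1 fun k _ => ?_).trans ?_
    · rw [ENNReal.ofReal_le_one]
      refine (tent_sub_sq_le L _ _).trans (le_of_eq ?_)
      have h2 : ((e : ℝ)) ^ 2 = 1 := by
        have : e ^ 2 = 1 := by rw [← sq_abs, he]; norm_num
        exact_mod_cast this
      push_cast
      rw [add_sub_cancel_left, h2]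
    · rw [Int.card_Icc, show ((L : ℤ) + 1 + 1 - -((L : ℤ) + 1)).toNat = 2 * L + 3 by omega,
        nsmul_eq_mul, mul_one, ← ENNReal.ofReal_natCast]
      push_cast
      exact le_rfl
  · have h1 : k ∉ Finset.Icc (-(L : ℤ)) L := by
      simp only [Finset.mem_Icc] at hk ⊢
      omega
    have h2 : k + e ∉ Finset.Icc (-(L : ℤ)) L := by
      simp only [Finset.mem_Icc] at hk ⊢
      have := abs_le.1 he.le
      omega
    rw [tent_eq_zero h1, tent_eq_zero h2]
    simp

theorem tsum_norm_sq_tent_mul (L : ℕ) (ψ : EllTwo) :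
    ∑' j, ENNReal.ofReal (‖mulPotential _ (isBoundedPotential_tent L j) ψ‖ ^ 2) =
      (∑' k, ENNReal.ofReal (tent L k ^ 2)) * ENNReal.ofReal (‖ψ‖ ^ 2) := by
  rw [ofReal_norm_sq_eq_tsum ψ, ← tsum_tsum_translate]
  refine tsum_congr fun j => ?_
  rw [ofReal_norm_sq_eq_tsum]
  refine tsum_congr fun n => ?_
  change ENNReal.ofReal (‖(tent L (n - j) : ℂ) * ψ n‖ ^ 2) = _
  rw [norm_mul, mul_pow, Complex.norm_real, Real.norm_eq_abs, sq_abs,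
    ENNReal.ofReal_mul (sq_nonneg _)]

/-- The commutator of the operator with a tent involves only differences of the tent at neighbouring
sites. Summing over all translates by Tonelli replaces these by their total square sum, linear in
`L`. -/
theorem tsum_norm_sq_schrodinger_tent_mul_le (L : ℕ) (V : ℤ → ℝ) (hV : IsBoundedPotential V)
    (t : ℂ) (ψ : EllTwo) :
    ∑' j, ENNReal.ofReal (‖schrodinger V hV (mulPotential _ (isBoundedPotential_tent L j) ψ) -
        t • mulPotential _ (isBoundedPotential_tent L j) ψ‖ ^ 2) ≤
      3 * ((∑' k, ENNReal.ofReal (tent L k ^ 2)) *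
          ENNReal.ofReal (‖schrodinger V hV ψ - t • ψ‖ ^ 2) +
        ENNReal.ofReal (2 * L + 3) * ENNReal.ofReal (‖ψ‖ ^ 2) +
        ENNReal.ofReal (2 * L + 3) * ENNReal.ofReal (‖ψ‖ ^ 2)) := by
  set χ := schrodinger V hV ψ - t • ψ
  have hshift : ∀ e : ℤ, |e| = 1 →
      ∑' j, ∑' n, ENNReal.ofReal ((tent L (n - j + e) - tent L (n - j)) ^ 2) *
        ENNReal.ofReal (‖ψ (n + e)‖ ^ 2) ≤
      ENNReal.ofReal (2 * L + 3) * ENNReal.ofReal (‖ψ‖ ^ 2) := by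
    intro e he
    rw [tsum_tsum_translate (fun k => ENNReal.ofReal ((tent L (k + e) - tent L k) ^ 2))
      fun n => ENNReal.ofReal (‖ψ (n + e)‖ ^ 2), ofReal_norm_sq_eq_tsum ψ]
    exact mul_le_mul' (tsum_tent_diff_le L he)
      ((Equiv.addRight e).tsum_eq fun n => ENNReal.ofReal (‖ψ n‖ ^ 2)).le
  calc
    _ ≤ ∑' j, ∑' n, 3 * (ENNReal.ofReal (tent L (n - j) ^ 2) * ENNReal.ofReal (‖χ n‖ ^ 2) +
        ENNReal.ofReal ((tent L (n - j + 1) - tent L (n - j)) ^ 2) *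
          ENNReal.ofReal (‖ψ (n + 1)‖ ^ 2) +
        ENNReal.ofReal ((tent L (n - j + -1) - tent L (n - j)) ^ 2) *
          ENNReal.ofReal (‖ψ (n + -1)‖ ^ 2)) := by
      refine ENNReal.tsum_le_tsum fun j => ?_
      rw [ofReal_norm_sq_eq_tsum]
      refine ENNReal.tsum_le_tsum fun n => ?_
      have e1 : ((schrodinger V hV (mulPotential _ (isBoundedPotential_tent L j) ψ) -
          t • mulPotential _ (isBoundedPotential_tent L j) ψ : EllTwo) : ℤ → ℂ) n =
          (tent L (n - j) : ℂ) * χ n +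
          ((tent L (n - j + 1) - tent L (n - j) : ℝ) : ℂ) * ψ (n + 1) +
          ((tent L (n - j + -1) - tent L (n - j) : ℝ) : ℂ) * ψ (n + -1) := by
        change (tent L (n + 1 - j) : ℂ) * ψ (n + 1) + (tent L (n - 1 - j) : ℂ) * ψ (n - 1) +
          (V n : ℂ) * ((tent L (n - j) : ℂ) * ψ n) - t * ((tent L (n - j) : ℂ) * ψ n) =
          (tent L (n - j) : ℂ) * (ψ (n + 1) + ψ (n - 1) + (V n : ℂ) * ψ n - t * ψ n) + _ + _
        rw [show n + 1 - j = n - j + 1 by ring, show n - 1 - j = n - j + -1 by ring,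
          show n + -1 = n - 1 by ring]
        push_cast
        ring
      rw [e1]
      refine (ENNReal.ofReal_le_ofReal (norm_sq_add_three_le _ _ _)).trans (le_of_eq ?_)
      rw [ENNReal.ofReal_mul (by norm_num), ENNReal.ofReal_add (by positivity) (by positivity),
        ENNReal.ofReal_add (by positivity) (by positivity)]
      simp only [norm_mul, mul_pow, Complex.norm_real, Real.norm_eq_abs, sq_abs]
      rw [ENNReal.ofReal_mul (sq_nonneg _), ENNReal.ofReal_mul (sq_nonneg _),
        ENNReal.ofReal_mul (sq_nonneg _), ENNReal.ofReal_ofNat]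
    _ ≤ _ := by
      simp only [ENNReal.tsum_mul_left, ENNReal.tsum_add]
      gcongr
      · rw [ofReal_norm_sq_eq_tsum χ]
        exact (tsum_tsum_translate (fun k => ENNReal.ofReal (tent L k ^ 2))
          fun n => ENNReal.ofReal (‖χ n‖ ^ 2)).le
      · exact hshift 1 (by simp)
      · exact hshift (-1) (by simp)

/-- Approximate eigenvectors of Schrödinger operators can be localized to windows whose length
depends only on the quality of the approximation. -/
theorem exists_localized_approx {ε : ℝ} (hε : 0 < ε) :
    ∃ L : ℕ, ∀ (V : ℤ → ℝ) (hV : IsBoundedPotential V) (t : ℂ) (ψ : EllTwo), ψ ≠ 0 →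
      ‖schrodinger V hV ψ - t • ψ‖ < ε * ‖ψ‖ →
      ∃ (j : ℤ) (φ : EllTwo), φ ≠ 0 ∧ (∀ n ∉ Finset.Icc (j - L) (j + L), φ n = 0) ∧
        (∀ n, ψ n = 0 → φ n = 0) ∧ ‖schrodinger V hV φ - t • φ‖ < 3 * ε * ‖φ‖ := by
  -- If every translate failed, the averaged inequality would give `ε ^ 2 * L ^ 2 ≤ 2 * L + 3 < 5 *
  -- L`, contradicting `5 / ε ^ 2 < L`.
  obtain ⟨L, hL⟩ := exists_nat_gt (max 1 (5 / ε ^ 2))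
  have hL1 : (1 : ℝ) < L := (le_max_left _ _).trans_lt hL
  have hL2 : 5 / ε ^ 2 < (L : ℝ) := (le_max_right _ _).trans_lt hL
  rw [div_lt_iff₀ (by positivity)] at hL2
  refine ⟨L, fun V hV t ψ hψ hlt => ?_⟩
  by_contra! hcon
  set φ : ℤ → EllTwo := fun j => mulPotential _ (isBoundedPotential_tent L j) ψ with hφ
  have hval : ∀ j n, φ j n = (tent L (n - j) : ℂ) * ψ n := fun j n => rfl
  have hall : ∀ j, 3 * ε * ‖φ j‖ ≤ ‖schrodinger V hV (φ j) - t • φ j‖ := by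
    intro j
    rcases eq_or_ne (φ j) 0 with h0 | h0
    · rw [h0]
      simp
    · refine hcon j (φ j) h0 (fun n hn => ?_) fun n hn => ?_
      · rw [hval, tent_eq_zero, Complex.ofReal_zero, zero_mul]
        simp only [Finset.mem_Icc] at hn ⊢
        omega
      · rw [hval, hn, mul_zero]
  have hsum : ENNReal.ofReal ((3 * ε) ^ 2) * ∑' j, ENNReal.ofReal (‖φ j‖ ^ 2) ≤
      ∑' j, ENNReal.ofReal (‖schrodinger V hV (φ j) - t • φ j‖ ^ 2) := by
    rw [← ENNReal.tsum_mul_left]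
    refine ENNReal.tsum_le_tsum fun j => ?_
    rw [← ENNReal.ofReal_mul (by positivity), ← mul_pow]
    have := hall j
    gcongr
  have hmain := hsum.trans (tsum_norm_sq_schrodinger_tent_mul_le L V hV t ψ)
  rw [hφ, tsum_norm_sq_tent_mul] at hmain
  have hS := le_tsum_tent_sq L
  rw [← ENNReal.ofReal_toReal (tsum_tent_sq_ne_top L)] at hmain hS
  set S := (∑' k, ENNReal.ofReal (tent L k ^ 2)).toReal
  have hS0 : 0 ≤ S := ENNReal.toReal_nonneg
  rw [ENNReal.ofReal_le_ofReal_iff hS0] at hS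
  rw [← ENNReal.ofReal_mul hS0, ← ENNReal.ofReal_mul hS0, ← ENNReal.ofReal_mul (by positivity),
    ← ENNReal.ofReal_mul (by positivity), ← ENNReal.ofReal_add (by positivity) (by positivity),
    ← ENNReal.ofReal_add (by positivity) (by positivity),
    show (3 : ℝ≥0∞) = ENNReal.ofReal 3 by simp, ← ENNReal.ofReal_mul (by norm_num),
    ENNReal.ofReal_le_ofReal_iff (by positivity)] at hmain
  have hψ' : 0 < ‖ψ‖ ^ 2 := by
    have := norm_pos_iff.2 hψ
    positivity
  have hsq : ‖schrodinger V hV ψ - t • ψ‖ ^ 2 ≤ ε ^ 2 * ‖ψ‖ ^ 2 := by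
    rw [← mul_pow]
    gcongr
  have h1 : S * ‖schrodinger V hV ψ - t • ψ‖ ^ 2 ≤ S * (ε ^ 2 * ‖ψ‖ ^ 2) :=
    mul_le_mul_of_nonneg_left hsq hS0
  have h2 : (ε ^ 2 * S) * ‖ψ‖ ^ 2 ≤ (2 * L + 3) * ‖ψ‖ ^ 2 := by nlinarith
  have h3 : ε ^ 2 * S ≤ 2 * L + 3 := le_of_mul_le_mul_right h2 hψ'
  have h4 : ε ^ 2 * (L : ℝ) ^ 2 ≤ ε ^ 2 * S := mul_le_mul_of_nonneg_left hS (by positivity)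
  nlinarith

end Localization

end RandomSchrodinger

namespace RandomSchrodinger

/-! ### Independence and the second Borel–Cantelli lemma -/

section Recurrence

open ProbabilityTheory Filter

instance (ν : Measure ℝ) [IsProbabilityMeasure ν] : IsProbabilityMeasure (iidLaw ν) :=
  inferInstanceAs (IsProbabilityMeasure (Measure.infinitePi fun _ : ℤ => ν))

theorem ae_forall_mem_support (ν : Measure ℝ) [IsProbabilityMeasure ν] :
    ∀ᵐ ω ∂(iidLaw ν), ∀ n, ω n ∈ ν.support := by
  rw [ae_all_iff]
  intro n
  exact (measurePreserving_eval_infinitePi (fun _ : ℤ => ν) n).quasiMeasurePreserving.ae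
    (p := fun x => x ∈ ν.support) Measure.support_mem_ae

/-- Cover the compact support by finitely many balls of radius `δ / 2` centred in it; each ball of
radius `δ` about a support point contains one of them. -/
theorem exists_pos_le_measure_ball {ν : Measure ℝ} (h : Bornology.IsBounded ν.support) {δ : ℝ}
    (hδ : 0 < δ) : ∃ p : ℝ≥0∞, 0 < p ∧ p ≤ 1 ∧ ∀ x ∈ ν.support, p ≤ ν (Metric.ball x δ) := by
  have hK : IsCompact ν.support := Metric.isCompact_of_isClosed_isBounded Measure.isClosed_support h
  obtain ⟨t, ht, hfin, hcover⟩ := hK.finite_cover_balls (half_pos hδ)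
  refine ⟨min (hfin.toFinset.inf fun x => ν (Metric.ball x (δ / 2))) 1, ?_, min_le_right _ _, ?_⟩
  · refine lt_min ((Finset.lt_inf_iff ENNReal.zero_lt_top).2 fun x hx => ?_) one_pos
    exact (Measure.mem_support_iff_forall x).1 (ht (hfin.mem_toFinset.1 hx)) _
      (Metric.ball_mem_nhds x (half_pos hδ))
  · intro x hx
    obtain ⟨y, hy, hxy⟩ := Set.mem_iUnion₂.1 (hcover hx)
    refine (min_le_left _ _).trans ((Finset.inf_le (hfin.mem_toFinset.2 hy)).trans
      (measure_mono (Metric.ball_subset_ball' ?_)))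
    rw [dist_comm]
    linarith [Metric.mem_ball.1 hxy]

theorem iIndepSet_pi_of_disjoint (ν : Measure ℝ) [IsProbabilityMeasure ν] {W : ℕ → Finset ℤ}
    (hW : Pairwise (Function.onFun Disjoint W)) {B : ℕ → ℤ → Set ℝ}
    (hB : ∀ k n, MeasurableSet (B k n)) :
    iIndepSet (fun k => Set.pi (W k : Set ℤ) (B k)) (iidLaw ν) := by
  rw [iIndepSet_iff_meas_biInter fun k => MeasurableSet.pi (W k).countable_toSet fun n _ => hB k n]
  intro S
  -- As the windows are disjoint, at most one `k ∈ S` constrains each coordinate, so the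
  -- intersection is again a product set.
  set t : ℤ → Set ℝ := fun n => ⋂ k ∈ S, {x | n ∈ W k → x ∈ B k n} with ht
  have htm : ∀ n, MeasurableSet (t n) := fun n =>
    Finset.measurableSet_biInter S fun k _ => by
      by_cases h : n ∈ W k <;> simp [h, hB k n]
  have hinter : ⋂ k ∈ S, Set.pi (W k : Set ℤ) (B k) = Set.pi (S.biUnion W : Set ℤ) t := by
    ext ω
    simp only [ht, Set.mem_iInter, Set.mem_pi, Finset.mem_coe, Finset.mem_biUnion,
      Set.mem_ofPred_eq]
    exact ⟨fun h n _ k hk hn => h k hk n hn, fun h k hk n hn => h n ⟨k, hk, hn⟩ k hk hn⟩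
  rw [hinter, iidLaw, Measure.infinitePi_pi _ fun n _ => htm n,
    Finset.prod_biUnion fun i _ j _ hij => hW hij]
  refine Finset.prod_congr rfl fun k hk => ?_
  rw [Measure.infinitePi_pi _ fun n _ => hB k n]
  refine Finset.prod_congr rfl fun n hn => ?_
  congr 1
  ext x
  simp only [ht, Set.mem_iInter, Set.mem_ofPred_eq]
  refine ⟨fun h => h k hk hn, fun h j _ hj => ?_⟩
  have : j = k := by
    by_contra hjk
    exact Finset.disjoint_left.1 (hW hjk) hj hn
  rwa [this]

/-- The events are independent and, since the windows have bounded cardinality, their probabilities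
are at least the fixed number `p ^ m > 0`; hence their sum diverges. -/
theorem ae_frequently_close {ν : Measure ℝ} [IsProbabilityMeasure ν]
    (h : Bornology.IsBounded ν.support) {W : ℕ → Finset ℤ}
    (hW : Pairwise (Function.onFun Disjoint W)) {m : ℕ} (hm : ∀ k, (W k).card ≤ m)
    {q : ℕ → ℤ → ℝ} (hq : ∀ k n, q k n ∈ ν.support) {δ : ℝ} (hδ : 0 < δ) :
    ∀ᵐ ω ∂(iidLaw ν), ∃ᶠ k in atTop, ∀ n ∈ W k, |ω n - q k n| < δ := by
  obtain ⟨p, hp0, hp1, hp⟩ := exists_pos_le_measure_ball h hδ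
  set s : ℕ → Set (ℤ → ℝ) := fun k => Set.pi (W k : Set ℤ) fun n => Metric.ball (q k n) δ with hs
  have hsm : ∀ k, MeasurableSet (s k) := fun k =>
    MeasurableSet.pi (W k).countable_toSet fun n _ => measurableSet_ball
  have hmeas : ∀ k, p ^ m ≤ iidLaw ν (s k) := by
    intro k
    rw [hs, iidLaw, Measure.infinitePi_pi _ fun n _ => measurableSet_ball]
    calc p ^ m ≤ p ^ (W k).card := pow_le_pow_right_of_le_one' hp1 (hm k)
      _ = ∏ n ∈ W k, p := (Finset.prod_const p).symm
      _ ≤ _ := Finset.prod_le_prod' fun n _ => hp _ (hq k n)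
  have hsum : ∑' k, iidLaw ν (s k) = ∞ := by
    refine top_unique ((ENNReal.tsum_const_eq_top_of_ne_zero (α := ℕ)
      (pow_ne_zero m hp0.ne')).ge.trans (ENNReal.tsum_le_tsum hmeas))
  have hone := measure_limsup_eq_one hsm
    (iIndepSet_pi_of_disjoint ν hW fun _ _ => measurableSet_ball) hsum
  have hae : ∀ᵐ ω ∂(iidLaw ν), ω ∈ limsup s atTop :=
    (mem_ae_iff_prob_eq_one (MeasurableSet.measurableSet_limsup hsm)).2 hone
  filter_upwards [hae] with ω hω
  rw [mem_limsup_iff_frequently_mem] at hω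
  exact hω.mono fun k hk n hn => hk n hn

/-- If a property of configurations on windows of bounded cardinality can be realized by values in
the support away from any finite set, then almost every sequence is close to such configurations
away from any finite set. -/
theorem ae_exists_close {ν : Measure ℝ} [IsProbabilityMeasure ν]
    (h : Bornology.IsBounded ν.support) (Good : Finset ℤ → (ℤ → ℝ) → Prop) (m : ℕ)
    (hgood : ∀ s : Finset ℤ, ∃ W q, W.card ≤ m ∧ Disjoint W s ∧ (∀ n, q n ∈ ν.support) ∧ Good W q)
    {δ : ℝ} (hδ : 0 < δ) :
    ∀ᵐ ω ∂(iidLaw ν), ∀ s : Finset ℤ, ∃ W q, Disjoint W s ∧ (∀ n, q n ∈ ν.support) ∧ Good W q ∧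
      ∀ n ∈ W, |ω n - q n| < δ := by
  rw [ae_all_iff]
  intro s
  have hsymm : Std.Symm fun x y : Finset ℤ × (ℤ → ℝ) => Disjoint x.1 y.1 :=
    ⟨fun _ _ hxy => hxy.symm⟩
  -- Windows are chosen successively, each avoiding `s` and all earlier windows.
  obtain ⟨F, hF, hdisj⟩ := exists_seq_of_forall_finset_exists'
    (fun x : Finset ℤ × (ℤ → ℝ) =>
      x.1.card ≤ m ∧ Disjoint x.1 s ∧ (∀ n, x.2 n ∈ ν.support) ∧ Good x.1 x.2)
    (fun x y => Disjoint x.1 y.1) (fun A _ => by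
      obtain ⟨W, q, hc, hd, hq, hg⟩ := hgood (s ∪ A.biUnion Prod.fst)
      rw [Finset.disjoint_union_right] at hd
      exact ⟨(W, q), ⟨hc, hd.1, hq, hg⟩, fun x hx =>
        (hd.2.mono_right (Finset.subset_biUnion_of_mem Prod.fst hx)).symm⟩)
  filter_upwards [ae_frequently_close h (W := fun k => (F k).1) (q := fun k => (F k).2) hdisj
    (fun k => (hF k).1) (fun k => (hF k).2.2.1) hδ] with ω hω
  obtain ⟨k, hk⟩ := hω.exists
  exact ⟨(F k).1, (F k).2, (hF k).2.1, (hF k).2.2.1, (hF k).2.2.2, hk⟩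

end Recurrence

end RandomSchrodinger

namespace RandomSchrodinger

/-! ### Approximate eigenvectors supported in finite windows -/

section WindowCriterion

theorem IsBoundedPotential.add {V W : ℤ → ℝ} (hV : IsBoundedPotential V)
    (hW : IsBoundedPotential W) : IsBoundedPotential fun n => V n + W n := by
  obtain ⟨C, hC⟩ := hV
  obtain ⟨D, hD⟩ := hW
  exact ⟨C + D, fun n => (abs_add_le _ _).trans (add_le_add (hC n) (hD n))⟩

theorem isBoundedPotential_of_mem {K : Set ℝ} (hK : Bornology.IsBounded K) {ω : ℤ → ℝ}
    (hω : ∀ n, ω n ∈ K) : IsBoundedPotential ω := by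
  obtain ⟨C, hC⟩ := hK.exists_norm_le
  exact ⟨C, fun n => hC _ (hω n)⟩

/-- The Schrödinger operator with potential `V` has an approximate eigenvector supported in `W`,
for the approximate eigenvalue `t`, with relative error smaller than `ε`. -/
def HasApproxEigenvector (V : ℤ → ℝ) (t ε : ℝ) (W : Finset ℤ) : Prop :=
  ∃ (hV : IsBoundedPotential V) (ψ : EllTwo), ψ ≠ 0 ∧ (∀ n ∉ W, ψ n = 0) ∧
    ‖schrodinger V hV ψ - (t : ℂ) • ψ‖ < ε * ‖ψ‖

theorem HasApproxEigenvector.change_eigenvalue {V : ℤ → ℝ} {t ε : ℝ} {W : Finset ℤ}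
    (h : HasApproxEigenvector V t ε W) (t' : ℝ) : HasApproxEigenvector V t' (ε + |t - t'|) W := by
  obtain ⟨hV, ψ, h0, hW, hlt⟩ := h
  refine ⟨hV, ψ, h0, hW, ?_⟩
  have e : schrodinger V hV ψ - (t' : ℂ) • ψ =
      (schrodinger V hV ψ - (t : ℂ) • ψ) + ((t - t' : ℝ) : ℂ) • ψ := by
    push_cast
    rw [sub_smul]
    abel
  rw [e, add_mul]
  refine (norm_add_le _ _).trans_lt ?_
  rw [norm_smul, Complex.norm_real, Real.norm_eq_abs]
  linarith

/-- The test vector vanishes off `W`, so only the values of the potentials on `W` matter. -/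
theorem HasApproxEigenvector.change_potential {V V' : ℤ → ℝ} {t ε δ : ℝ} {W : Finset ℤ}
    (h : HasApproxEigenvector V t ε W) (hV' : IsBoundedPotential V')
    (hclose : ∀ n ∈ W, |V' n - V n| ≤ δ) : HasApproxEigenvector V' t (ε + δ) W := by
  obtain ⟨hV, ψ, h0, hW, hlt⟩ := h
  refine ⟨hV', ψ, h0, hW, ?_⟩
  have hδ : ‖schrodinger V' hV' ψ - schrodinger V hV ψ‖ ≤ δ * ‖ψ‖ := by
    have hne : W.Nonempty := by
      by_contra hne
      rw [Finset.not_nonempty_iff_eq_empty] at hne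
      exact h0 (lp.ext (funext fun n => hW n (by simp [hne])))
    obtain ⟨m, hm⟩ := hne
    have hδ0 : 0 ≤ δ := (abs_nonneg _).trans (hclose m hm)
    have h1 : ‖schrodinger V' hV' ψ - schrodinger V hV ψ‖ ≤ ‖(δ : ℂ) • ψ‖ := by
      refine lp.norm_mono (p := 2) (by norm_num) fun n => ?_
      have e : ((schrodinger V' hV' ψ - schrodinger V hV ψ : EllTwo) : ℤ → ℂ) n =
          ((V' n - V n : ℝ) : ℂ) * ψ n := by
        rw [lp.coeFn_sub, Pi.sub_apply, schrodinger_apply, schrodinger_apply]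
        push_cast
        ring
      rw [e, lp.coeFn_smul, Pi.smul_apply, smul_eq_mul, norm_mul, norm_mul, Complex.norm_real,
        Complex.norm_real, Real.norm_eq_abs, Real.norm_eq_abs, abs_of_nonneg hδ0]
      by_cases hn : n ∈ W
      · exact mul_le_mul_of_nonneg_right (hclose n hn) (norm_nonneg _)
      · simp [hW n hn]
    rwa [norm_smul, Complex.norm_real, Real.norm_eq_abs, abs_of_nonneg hδ0] at h1
  have e : schrodinger V' hV' ψ - (t : ℂ) • ψ =
      (schrodinger V hV ψ - (t : ℂ) • ψ) + (schrodinger V' hV' ψ - schrodinger V hV ψ) := by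
    abel
  rw [e, add_mul]
  exact (norm_add_le _ _).trans_lt (by linarith)

theorem norm_reindex (e : ℤ ≃ ℤ) (ψ : EllTwo) : ‖reindex e ψ‖ = ‖ψ‖ := by
  have h : inner ℂ (reindex e ψ) (reindex e ψ) = inner ℂ ψ ψ := by
    rw [inner_reindex]
    congr 1
    ext n
    change ψ (e (e.symm n)) = ψ n
    rw [e.apply_symm_apply]
  rw [inner_self_eq_norm_sq_to_K, inner_self_eq_norm_sq_to_K] at h
  have h' : ‖reindex e ψ‖ ^ 2 = ‖ψ‖ ^ 2 := by exact_mod_cast h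
  exact (sq_eq_sq₀ (norm_nonneg _) (norm_nonneg _)).1 h'

theorem HasApproxEigenvector.translate {V : ℤ → ℝ} {t ε : ℝ} {W : Finset ℤ}
    (h : HasApproxEigenvector V t ε W) (m : ℤ) :
    HasApproxEigenvector (fun n => V (n - m)) t ε (W.map (Equiv.addRight m).toEmbedding) := by
  obtain ⟨hV, ψ, h0, hW, hlt⟩ := h
  have hV' : IsBoundedPotential fun n => V (n - m) := hV.imp fun C hC n => hC (n - m)
  refine ⟨hV', reindex (Equiv.subRight m) ψ, ?_, fun n hn => ?_, ?_⟩
  · rwa [← norm_ne_zero_iff, norm_reindex, norm_ne_zero_iff]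
  · refine hW (n - m) fun hmem => hn ?_
    rw [Finset.mem_map_equiv]
    exact hmem
  · have e : schrodinger _ hV' (reindex (Equiv.subRight m) ψ) -
        (t : ℂ) • reindex (Equiv.subRight m) ψ =
        reindex (Equiv.subRight m) (schrodinger V hV ψ - (t : ℂ) • ψ) := by
      ext n
      change ψ (n + 1 - m) + ψ (n - 1 - m) + (V (n - m) : ℂ) * ψ (n - m) - t * ψ (n - m) =
        ψ (n - m + 1) + ψ (n - m - 1) + (V (n - m) : ℂ) * ψ (n - m) - t * ψ (n - m)
      rw [show n + 1 - m = n - m + 1 by ring, show n - 1 - m = n - m - 1 by ring]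
    rw [e, norm_reindex, norm_reindex]
    exact hlt

/-- Localization in terms of approximate eigenvectors on windows of bounded cardinality. -/
theorem exists_hasApproxEigenvector {ε : ℝ} (hε : 0 < ε) :
    ∃ m : ℕ, ∃ δ : ℝ, 0 < δ ∧ ∀ (V : ℤ → ℝ) (hV : IsBoundedPotential V) (t : ℝ) (ψ : EllTwo)
      (s : Finset ℤ), ψ ≠ 0 → (∀ n ∈ s, ψ n = 0) →
      ‖schrodinger V hV ψ - (t : ℂ) • ψ‖ < δ * ‖ψ‖ →
      ∃ W : Finset ℤ, W.card ≤ m ∧ Disjoint W s ∧ HasApproxEigenvector V t ε W := by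
  obtain ⟨L, hL⟩ := exists_localized_approx (ε := ε / 3) (by positivity)
  refine ⟨2 * L + 1, ε / 3, by positivity, fun V hV t ψ s h0 hs hlt => ?_⟩
  obtain ⟨j, φ, hφ0, hφW, hφψ, hφlt⟩ := hL V hV t ψ h0 hlt
  -- Sites of `s` may be removed because the localized vector vanishes wherever `ψ` does.
  refine ⟨Finset.Icc (j - L) (j + L) \ s, ?_, Finset.sdiff_disjoint, hV, φ, hφ0, fun n hn => ?_, ?_⟩
  · refine (Finset.card_le_card Finset.sdiff_subset).trans (le_of_eq ?_)
    rw [Int.card_Icc]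
    omega
  · rw [Finset.mem_sdiff, not_and_not_right] at hn
    by_cases hmem : n ∈ Finset.Icc (j - (L : ℤ)) (j + L)
    · exact hφψ n (hs n (hn hmem))
    · exact hφW n hmem
  · rwa [mul_div_cancel₀ ε (by norm_num : (3 : ℝ) ≠ 0)] at hφlt

/-- The set of energies at which the potentials `Vbg + q`, with `q` taking values in `K`, admit
approximate eigenvectors on windows of bounded cardinality away from any finite set. -/
def windowSpectrum (Vbg : ℤ → ℝ) (K : Set ℝ) : Set ℝ :=
  {t | ∀ ε : ℝ, 0 < ε → ∃ m : ℕ, ∀ s : Finset ℤ, ∃ (W : Finset ℤ) (q : ℤ → ℝ), W.card ≤ m ∧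
    Disjoint W s ∧ (∀ n, q n ∈ K) ∧ HasApproxEigenvector (fun n => Vbg n + q n) t ε W}

theorem windowSpectrum_mono (Vbg : ℤ → ℝ) {K K' : Set ℝ} (h : K ⊆ K') :
    windowSpectrum Vbg K ⊆ windowSpectrum Vbg K' := by
  intro t ht ε hε
  obtain ⟨m, hm⟩ := ht ε hε
  refine ⟨m, fun s => ?_⟩
  obtain ⟨W, q, hc, hd, hq, ha⟩ := hm s
  exact ⟨W, q, hc, hd, fun n => h (hq n), ha⟩

theorem isClosed_windowSpectrum (Vbg : ℤ → ℝ) (K : Set ℝ) : IsClosed (windowSpectrum Vbg K) := by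
  refine isClosed_of_closure_subset fun t ht ε hε => ?_
  obtain ⟨t', ht', hdist⟩ := Metric.mem_closure_iff.1 ht (ε / 2) (half_pos hε)
  rw [dist_comm, Real.dist_eq] at hdist
  obtain ⟨m, hm⟩ := ht' (ε - |t' - t|) (by linarith)
  refine ⟨m, fun s => ?_⟩
  obtain ⟨W, q, hc, hd, hq, ha⟩ := hm s
  refine ⟨W, q, hc, hd, hq, ?_⟩
  have := ha.change_eigenvalue t
  rwa [sub_add_cancel] at this

theorem essentialSpectrum_subset_windowSpectrum {Vbg : ℤ → ℝ} {K : Set ℝ} {ω : ℤ → ℝ}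
    (hω : ∀ n, ω n ∈ K) (hV : IsBoundedPotential fun n => Vbg n + ω n) :
    essentialSpectrum (schrodinger _ hV) ⊆ Complex.ofReal '' windowSpectrum Vbg K := by
  intro z hz
  have hA := isSelfAdjoint_schrodinger _ hV
  have hre : z = z.re := hA.mem_spectrum_eq_re hz.1
  refine ⟨z.re, fun ε hε => ?_, hre.symm⟩
  rw [hre, mem_essentialSpectrum_iff hA] at hz
  obtain ⟨m, δ, hδ, hm⟩ := exists_hasApproxEigenvector hε
  refine ⟨m, fun s => ?_⟩
  obtain ⟨ψ, h0, hs, hlt⟩ := hz δ hδ s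
  obtain ⟨W, hc, hd, ha⟩ := hm _ hV z.re ψ s h0 hs hlt
  exact ⟨W, ω, hc, hd, hω, ha⟩

theorem mem_essentialSpectrum_of_windows {V : ℤ → ℝ} (hV : IsBoundedPotential V) {t : ℝ}
    (h : ∀ ε : ℝ, 0 < ε → ∀ s : Finset ℤ, ∃ W, Disjoint W s ∧ HasApproxEigenvector V t ε W) :
    (t : ℂ) ∈ essentialSpectrum (schrodinger V hV) := by
  rw [mem_essentialSpectrum_iff (isSelfAdjoint_schrodinger V hV)]
  intro ε hε s
  obtain ⟨W, hd, _, ψ, h0, hW, hlt⟩ := h ε hε s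
  exact ⟨ψ, h0, fun n hn => hW n (Finset.disjoint_right.1 hd hn), hlt⟩

end WindowCriterion

/-! ### The almost sure essential spectrum -/

section AlmostSure

variable {ν : Measure ℝ} [IsProbabilityMeasure ν]

theorem ae_windowSpectrum_subset (Vbg : ℤ → ℝ)
    (h : Bornology.IsBounded ν.support) :
    ∀ᵐ ω ∂(iidLaw ν), ∀ hV : IsBoundedPotential fun n => Vbg n + ω n,
      Complex.ofReal '' windowSpectrum Vbg ν.support ⊆ essentialSpectrum (schrodinger _ hV) := by
  -- A countable dense set of energies keeps the exceptional set null; the other energies follow by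
  -- approximation.
  obtain ⟨D, hDs, hDc, hD⟩ := (TopologicalSpace.IsSeparable.of_separableSpace
    (windowSpectrum Vbg ν.support)).exists_countable_dense_subset
  have hae : ∀ᵐ ω ∂(iidLaw ν), ∀ t ∈ D, ∀ k : ℕ, ∀ s : Finset ℤ,
      ∃ (W : Finset ℤ) (q : ℤ → ℝ), Disjoint W s ∧
      (∀ n, q n ∈ ν.support) ∧
      HasApproxEigenvector (fun n => Vbg n + q n) t (1 / ((k : ℝ) + 1)) W ∧
      ∀ n ∈ W, |ω n - q n| < 1 / ((k : ℝ) + 1) := by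
    rw [ae_ball_iff hDc]
    intro t ht
    rw [ae_all_iff]
    intro k
    obtain ⟨m, hm⟩ := hDs ht (1 / ((k : ℝ) + 1)) (by positivity)
    exact ae_exists_close h
      (fun W q => HasApproxEigenvector (fun n => Vbg n + q n) t (1 / ((k : ℝ) + 1)) W) m hm
      (by positivity)
  filter_upwards [hae] with ω hω hV
  rintro _ ⟨t, ht, rfl⟩
  refine mem_essentialSpectrum_of_windows hV fun ε hε s => ?_
  obtain ⟨t', ht', hdist⟩ := Metric.mem_closure_iff.1 (hD ht) (ε / 3) (by positivity)
  rw [dist_comm, Real.dist_eq] at hdist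
  -- One third of `ε` each for the test vector, the change of potential and the change of energy.
  obtain ⟨k, hk⟩ := exists_nat_one_div_lt (show 0 < ε / 3 by positivity)
  obtain ⟨W, q, hd, -, ha, hclose⟩ := hω t' ht' k s
  refine ⟨W, hd, ?_⟩
  have h1 := (ha.change_potential hV (δ := 1 / ((k : ℝ) + 1)) fun n hn => by
    rw [add_sub_add_left_eq_sub]
    exact (hclose n hn).le).change_eigenvalue t
  obtain ⟨hV', ψ, h0, hW, hlt⟩ := h1
  refine ⟨hV', ψ, h0, hW, hlt.trans_le ?_⟩
  gcongr
  linarith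

theorem isBounded_of_image_subset_spectrum {A : EllTwo →L[ℂ] EllTwo} {S : Set ℝ}
    (h : Complex.ofReal '' S ⊆ spectrum ℂ A) : Bornology.IsBounded S := by
  obtain ⟨C, hC⟩ := (spectrum.isBounded (𝕜 := ℂ) A).exists_norm_le
  refine isBounded_iff_forall_norm_le.2 ⟨C, fun t ht => ?_⟩
  simpa using hC _ (h ⟨t, ht, rfl⟩)

/-- The almost sure essential spectrum exists and is the window spectrum of the support. -/
theorem isAlmostSureEssentialSpectrum_windowSpectrum {Vbg : ℤ → ℝ} (hbg : IsBoundedPotential Vbg)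
    (h : Bornology.IsBounded ν.support) :
    IsAlmostSureEssentialSpectrum Vbg ν (windowSpectrum Vbg ν.support) := by
  have hae : ∀ᵐ ω ∂(iidLaw ν), ∃ hV : IsBoundedPotential (fun n => Vbg n + ω n),
      essentialSpectrum (schrodinger (fun n => Vbg n + ω n) hV) =
        Complex.ofReal '' windowSpectrum Vbg ν.support := by
    filter_upwards [ae_windowSpectrum_subset Vbg h, ae_forall_mem_support ν] with ω h1 h2
    have hV := hbg.add (isBoundedPotential_of_mem h h2)
    exact ⟨hV, (essentialSpectrum_subset_windowSpectrum h2 hV).antisymm (h1 hV)⟩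
  refine ⟨Metric.isCompact_of_isClosed_isBounded (isClosed_windowSpectrum _ _) ?_, hae⟩
  obtain ⟨ω, hV, hω⟩ := hae.exists
  exact isBounded_of_image_subset_spectrum (hω.symm.subset.trans Set.sdiff_subset)

theorem IsAlmostSureEssentialSpectrum.unique {Vbg : ℤ → ℝ} {S S' : Set ℝ}
    (hS : IsAlmostSureEssentialSpectrum Vbg ν S) (hS' : IsAlmostSureEssentialSpectrum Vbg ν S') :
    S = S' := by
  obtain ⟨ω, ⟨hV, h⟩, ⟨hV', h'⟩⟩ := (hS.2.and hS'.2).exists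
  exact Complex.ofReal_injective.image_injective (h.symm.trans h')

end AlmostSure

/-! ### Minimal background potentials and the almost sure spectrum -/

section Minimal

variable {X : Type*} [TopologicalSpace X]

/-- By compactness, finitely many times `I` suffice to bring every point into `U`. Each `k` is then
a return time minus an element of `I`, which is impossible for all `k` if there are only finitely
many returns. -/
theorem IsMinimalHomeo.infinite_returns [CompactSpace X] {T : X ≃ₜ X} (hT : IsMinimalHomeo T)
    {U : Set X} (hU : IsOpen U) (hne : U.Nonempty) (x : X) :
    {m : ℤ | (T ^ m) x ∈ U}.Infinite := by
  obtain ⟨I, hI⟩ := isCompact_univ.elim_finite_subcover (fun n : ℤ => (T ^ n) ⁻¹' U)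
    (fun n => hU.preimage (T ^ n).continuous) fun y _ => by
      obtain ⟨_, hz, n, rfl⟩ := (hT y).inter_open_nonempty U hU hne
      exact Set.mem_iUnion.2 ⟨n, hz⟩
  intro hfin
  obtain ⟨k, hk⟩ := Infinite.exists_notMem_finset
    ((hfin.toFinset ×ˢ I).image fun p => p.1 - p.2)
  obtain ⟨n, hn, hmem⟩ := Set.mem_iUnion₂.1 (hI (Set.mem_univ ((T ^ k) x)))
  refine hk (Finset.mem_image.2 ⟨(n + k, n), Finset.mem_product.2 ⟨?_, hn⟩, by simp⟩)
  rw [Set.Finite.mem_toFinset]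
  change (T ^ (n + k)) x ∈ U
  rw [zpow_add]
  exact hmem

/-- The set of energies at which some potential `n ↦ f (T^n x) + q n`, with `q` taking values in
`K`, admits approximate eigenvectors of finite support. -/
def orbitSpectrum (T : X ≃ₜ X) (f : C(X, ℝ)) (K : Set ℝ) : Set ℝ :=
  {t | ∀ ε : ℝ, 0 < ε → ∃ (x : X) (q : ℤ → ℝ) (W : Finset ℤ), (∀ n, q n ∈ K) ∧
    HasApproxEigenvector (fun n => f ((T ^ n) x) + q n) t ε W}

theorem orbitSpectrum_mono (T : X ≃ₜ X) (f : C(X, ℝ)) {K K' : Set ℝ} (h : K ⊆ K') :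
    orbitSpectrum T f K ⊆ orbitSpectrum T f K' := by
  intro t ht ε hε
  obtain ⟨x, q, W, hq, ha⟩ := ht ε hε
  exact ⟨x, q, W, fun n => h (hq n), ha⟩

theorem isBoundedPotential_orbit [CompactSpace X] (T : X ≃ₜ X) (f : C(X, ℝ)) (x : X) :
    IsBoundedPotential fun n => f ((T ^ n) x) :=
  ⟨‖f‖, fun n => f.norm_coe_le_norm ((T ^ n) x)⟩

/-- A test vector over `y` sees finitely many values of `f`. By continuity these nearly recur
whenever the orbit of `x` is close to `y`, which happens at infinitely many times, so the vector can
be translated away from any finite set. -/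
theorem orbitSpectrum_eq_windowSpectrum [CompactSpace X] {T : X ≃ₜ X} (hT : IsMinimalHomeo T)
    (f : C(X, ℝ)) {K : Set ℝ} (hK : Bornology.IsBounded K) (x : X) :
    orbitSpectrum T f K = windowSpectrum (fun n => f ((T ^ n) x)) K := by
  apply Set.Subset.antisymm
  · intro t ht ε hε
    obtain ⟨y, q, W, hq, ha⟩ := ht (ε / 2) (half_pos hε)
    refine ⟨W.card, fun s => ?_⟩
    set U : Set X := ⋂ n ∈ W, {z | |f ((T ^ n) z) - f ((T ^ n) y)| < ε / 2} with hUdef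
    have hU : IsOpen U := isOpen_biInter_finset fun n _ =>
      isOpen_lt ((f.continuous.comp (T ^ n).continuous).sub continuous_const).abs continuous_const
    have hyU : y ∈ U := by
      simp [hUdef, hε]
    -- Avoiding all differences of a site in `s` and a site in `W` makes the translate of `W` by `m`
    -- disjoint from `s`.
    obtain ⟨m, hmU, hm⟩ := (hT.infinite_returns hU ⟨y, hyU⟩ x).exists_notMem_finset
      ((s ×ˢ W).image fun p => p.1 - p.2)
    refine ⟨W.map (Equiv.addRight m).toEmbedding, fun n => q (n - m), by simp, ?_,
      fun n => hq _, ?_⟩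
    · rw [Finset.disjoint_left]
      intro n hn hns
      obtain ⟨k, hk, rfl⟩ := Finset.mem_map.1 hn
      exact hm (Finset.mem_image.2 ⟨(_, k), Finset.mem_product.2 ⟨hns, hk⟩, by simp⟩)
    · have hV : IsBoundedPotential fun n => f ((T ^ n) x) + q (n - m) :=
        (isBoundedPotential_orbit T f x).add (isBoundedPotential_of_mem hK fun n => hq (n - m))
      have h1 := (ha.translate m).change_potential hV (δ := ε / 2) fun n hn => by
        obtain ⟨k, hk, rfl⟩ := Finset.mem_map.1 hn
        have h2 : |f ((T ^ k) ((T ^ m) x)) - f ((T ^ k) y)| < ε / 2 := Set.mem_iInter₂.1 hmU k hk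
        rw [← Homeomorph.mul_apply, ← zpow_add] at h2
        simpa using h2.le
      rwa [add_halves] at h1
  · intro t ht ε hε
    obtain ⟨m, hm⟩ := ht ε hε
    obtain ⟨W, q, -, -, hq, ha⟩ := hm ∅
    exact ⟨x, q, W, hq, ha⟩

theorem spectrum_subset_orbitSpectrum {T : X ≃ₜ X} {f : C(X, ℝ)} {K : Set ℝ} {x : X} {ω : ℤ → ℝ}
    (hω : ∀ n, ω n ∈ K) (hV : IsBoundedPotential fun n => f ((T ^ n) x) + ω n) :
    spectrum ℂ (schrodinger _ hV) ⊆ Complex.ofReal '' orbitSpectrum T f K := by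
  intro z hz
  have hA := isSelfAdjoint_schrodinger _ hV
  have hre : z = z.re := hA.mem_spectrum_eq_re hz
  refine ⟨z.re, fun ε hε => ?_, hre.symm⟩
  rw [hre, hA.mem_spectrum_iff_approx] at hz
  obtain ⟨m, δ, hδ, hm⟩ := exists_hasApproxEigenvector hε
  obtain ⟨ψ, h0, hlt⟩ := hz δ hδ
  obtain ⟨W, -, -, ha⟩ := hm _ hV z.re ψ ∅ h0 (by simp) hlt
  exact ⟨x, ω, W, hω, ha⟩

variable {ν : Measure ℝ} [IsProbabilityMeasure ν]

/-- The almost sure spectrum exists and is the orbit spectrum of the support. -/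
theorem isAlmostSureSpectrum_orbitSpectrum [CompactSpace X] [Nonempty X] {T : X ≃ₜ X}
    (hT : IsMinimalHomeo T) (f : C(X, ℝ)) (h : Bornology.IsBounded ν.support) :
    IsAlmostSureSpectrum T f ν (orbitSpectrum T f ν.support) := by
  have hess := fun x =>
    isAlmostSureEssentialSpectrum_windowSpectrum (isBoundedPotential_orbit T f x) h
  refine ⟨?_, fun x => ?_⟩
  · obtain ⟨x⟩ := ‹Nonempty X›
    rw [orbitSpectrum_eq_windowSpectrum hT f h x]
    exact (hess x).1
  · filter_upwards [(hess x).2, ae_forall_mem_support ν] with ω ⟨hV, h1⟩ h2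
    refine ⟨hV, (spectrum_subset_orbitSpectrum h2 hV).antisymm ?_⟩
    rw [orbitSpectrum_eq_windowSpectrum hT f h x, ← h1]
    exact Set.sdiff_subset

theorem IsAlmostSureSpectrum.unique [Nonempty X] {T : X ≃ₜ X} {f : C(X, ℝ)} {S S' : Set ℝ}
    (hS : IsAlmostSureSpectrum T f ν S) (hS' : IsAlmostSureSpectrum T f ν S') : S = S' := by
  obtain ⟨x⟩ := ‹Nonempty X›
  obtain ⟨ω, ⟨hV, h⟩, ⟨hV', h'⟩⟩ := ((hS.2 x).and (hS'.2 x)).exists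
  exact Complex.ofReal_injective.image_injective (h.symm.trans h')

end Minimal

end RandomSchrodinger

theorem theoremt
    (ν₁ ν₂ : Measure ℝ) [IsProbabilityMeasure ν₁] [IsProbabilityMeasure ν₂]
    (h₁ : Bornology.IsBounded ν₁.support) (h₂ : Bornology.IsBounded ν₂.support) :
    (∀ Vbg : ℤ → ℝ, RandomSchrodinger.IsBoundedPotential Vbg →
      (∃! S₁ : Set ℝ, RandomSchrodinger.IsAlmostSureEssentialSpectrum Vbg ν₁ S₁) ∧
      (∃! S₂ : Set ℝ, RandomSchrodinger.IsAlmostSureEssentialSpectrum Vbg ν₂ S₂) ∧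
      (ν₁.support ⊆ ν₂.support →
        ∀ S₁ S₂ : Set ℝ, RandomSchrodinger.IsAlmostSureEssentialSpectrum Vbg ν₁ S₁ →
          RandomSchrodinger.IsAlmostSureEssentialSpectrum Vbg ν₂ S₂ → S₁ ⊆ S₂)) ∧
    (∀ (X : Type*) [MetricSpace X] [CompactSpace X] [Nonempty X] (T : X ≃ₜ X),
      RandomSchrodinger.IsMinimalHomeo T → ∀ f : C(X, ℝ),
      (∃! S₁ : Set ℝ, RandomSchrodinger.IsAlmostSureSpectrum T f ν₁ S₁) ∧
      (∃! S₂ : Set ℝ, RandomSchrodinger.IsAlmostSureSpectrum T f ν₂ S₂) ∧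
      (ν₁.support ⊆ ν₂.support →
        ∀ S₁ S₂ : Set ℝ, RandomSchrodinger.IsAlmostSureSpectrum T f ν₁ S₁ →
          RandomSchrodinger.IsAlmostSureSpectrum T f ν₂ S₂ → S₁ ⊆ S₂)) := by

  refine ⟨fun Vbg hbg => ?_, fun X _ _ _ T hT f => ?_⟩
  · have e₁ := RandomSchrodinger.isAlmostSureEssentialSpectrum_windowSpectrum (ν := ν₁) hbg h₁
    have e₂ := RandomSchrodinger.isAlmostSureEssentialSpectrum_windowSpectrum (ν := ν₂) hbg h₂
    refine ⟨⟨_, e₁, fun S hS => hS.unique e₁⟩, ⟨_, e₂, fun S hS => hS.unique e₂⟩,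
      fun hsub S₁ S₂ hS₁ hS₂ => ?_⟩
    rw [hS₁.unique e₁, hS₂.unique e₂]
    exact RandomSchrodinger.windowSpectrum_mono Vbg hsub
  · have e₁ := RandomSchrodinger.isAlmostSureSpectrum_orbitSpectrum (ν := ν₁) hT f h₁
    have e₂ := RandomSchrodinger.isAlmostSureSpectrum_orbitSpectrum (ν := ν₂) hT f h₂
    refine ⟨⟨_, e₁, fun S hS => hS.unique e₁⟩, ⟨_, e₂, fun S hS => hS.unique e₂⟩,
      fun hsub S₁ S₂ hS₁ hS₂ => ?_⟩
    rw [hS₁.unique e₁, hS₂.unique e₂]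
    exact RandomSchrodinger.orbitSpectrum_mono T f hsub
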